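/- Let $d\ge 2$ be an integer and let $q,s$ be real numbers with $q\ge 1$ and $qs\ge 1$. For a unit vector $|\psi\rangle\in\mathbb{C}^d\otimes\mathbb{C}^d$ with reduced density operator $\rho_A=\operatorname{tr}_B|\psi\rangle\langle\psi|$, put $C_{q,s}(|\psi\rangle)=1-(\operatorname{tr}\rho_A^{\,q})^s$, and for a density matrix $\rho$ on $\mathbb{C}^d\otimes\mathbb{C}^d$ let the unified $(q,s)$-concurrence be the convex roof $$C_{q,s}(\rho)=\inf\sum_i p_i\,C_{q,s}(|\psi_i\rangle),$$ where the infimum is over all finite pure state decompositions $\rho=\sum_i p_i|\psi_i\rangle\langle\psi_i|$ with $p_i\ge 0$, $\sum_i p_i=1$ and unit vectors $|\psi_i\rangle$. Let $|\Psi^+\rangle=\frac{1}{\sqrt d}\sum_{i=1}^d|ii\rangle$, and for $F\in[0,1]$ let $$\rho_F=\frac{1-F}{d^2-1}\bigl(I-|\Psi^+\rangle\langle\Psi^+|\bigr)+F\,|\Psi^+\rangle\langle\Psi^+|$$ be the isotropic state. Then, for $F\in(\frac1d,1]$, $$C_{q,s}(\rho_F)=\mathrm{co}[\xi(F,q,s,d)],\qquad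 \xi(F,q,s,d)=1-\bigl(\gamma^{2q}+(d-1)\delta^{2q}\bigr)^s,$$ $$\gamma=\frac{1}{\sqrt d}\Bigl(\sqrt F+\sqrt{(d-1)(1-F)}\Bigr),\qquad \delta=\frac{1}{\sqrt d}\Bigl(\sqrt F-\frac{\sqrt{1-F}}{\sqrt{d-1}}\Bigr).$$ Here $\mathrm{co}$ denotes the convex envelope in the variable $F$ on the interval $(\frac1d,1]$. That is, the function $F\mapsto C_{q,s}(\rho_F)$ is the largest convex function on $(\frac1d,1]$ that is bounded above by $F\mapsto\xi(F,q,s,d)$. -/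

import Mathlib

noncomputable section

namespace UnifiedConcurrence

/-- The Hilbert space `ℂ^m ⊗ ℂ^n`, with the product basis `|i⟩ ⊗ |k⟩` indexed by pairs `(i, k)`. -/
abbrev Bipartite (m n : Type*) : Type _ := EuclideanSpace ℂ (m × n)

/-- The operator `|ψ⟩⟨ψ|`, as a matrix in the standard basis. -/
def ketBra {ι : Type*} (ψ : EuclideanSpace ℂ ι) : Matrix ι ι ℂ :=
  Matrix.vecMulVec ψ.ofLp (star ψ.ofLp)

/-- The partial trace over the second tensor factor. -/
def partialTraceB {m n : Type*} [Fintype n] (M : Matrix (m × n) (m × n) ℂ) : Matrix m m ℂ :=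
  Matrix.of fun i j => ∑ k, M (i, k) (j, k)

/-- The reduced density operator `ρ_A = tr_B |ψ⟩⟨ψ|`. -/
def reducedA {m n : Type*} [Fintype n] (ψ : Bipartite m n) : Matrix m m ℂ :=
  partialTraceB (ketBra ψ)

/-- `tr (A ^ q)` for a positive semidefinite matrix `A` and a real exponent `q`; the power is taken
by the continuous functional calculus. -/
def trPow {m : Type*} [Fintype m] [DecidableEq m] (A : Matrix m m ℂ) (q : ℝ) : ℝ :=
  (Matrix.trace (cfc (fun x : ℝ => x ^ q) A)).re

/-- The sign `ε_{q,s}`: it is `1` if `q ≥ 1` and `q s ≥ 1`, and `-1` in the other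
admissible range `0 < q < 1`, `0 < q s < 1`. -/
def signFactor (q s : ℝ) : ℝ :=
  open Classical in if 1 ≤ q ∧ 1 ≤ q * s then 1 else -1

/-- The unified `(q, s)`-concurrence of a bipartite pure state. -/
def pureConcurrence {m n : Type*} [Fintype m] [DecidableEq m] [Fintype n]
    (q s : ℝ) (ψ : Bipartite m n) : ℝ :=
  signFactor q s * (1 - (trPow (reducedA ψ) q) ^ s)

/-- The average concurrences `∑ i, p i * C_{q,s}(ψ i)` over all finite pure state decompositions
`ρ = ∑ i, p i |ψ i⟩⟨ψ i|`. -/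
def decompositionValues {m n : Type*} [Fintype m] [DecidableEq m] [Fintype n]
    (q s : ℝ) (ρ : Matrix (m × n) (m × n) ℂ) : Set ℝ :=
  {x | ∃ (N : ℕ) (p : Fin N → ℝ) (ψ : Fin N → Bipartite m n),
    (∀ i, 0 ≤ p i) ∧ ∑ i, p i = 1 ∧ (∀ i, ‖ψ i‖ = 1) ∧
    ρ = ∑ i, (p i : ℂ) • ketBra (ψ i) ∧
    x = ∑ i, p i * pureConcurrence q s (ψ i)}

/-- The unified `(q, s)`-concurrence of a mixed state: the convex roof extension. -/
def concurrence {m n : Type*} [Fintype m] [DecidableEq m] [Fintype n]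
    (q s : ℝ) (ρ : Matrix (m × n) (m × n) ℂ) : ℝ :=
  sInf (decompositionValues q s ρ)

/-- The maximally entangled state `|Ψ⁺⟩ = (1/√d) ∑ i, |i i⟩` on `ℂ^d ⊗ ℂ^d`. -/
def maxEntangled (d : ℕ) : Bipartite (Fin d) (Fin d) :=
  ((1 / Real.sqrt d : ℝ) : ℂ) • ∑ i : Fin d, EuclideanSpace.single (i, i) (1 : ℂ)

/-- The isotropic state `ρ_F` on `ℂ^d ⊗ ℂ^d`. -/
def isotropicState (d : ℕ) (F : ℝ) : Matrix (Fin d × Fin d) (Fin d × Fin d) ℂ :=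
  (((1 - F) / ((d : ℝ) ^ 2 - 1) : ℝ) : ℂ) • (1 - ketBra (maxEntangled d)) +
    (F : ℂ) • ketBra (maxEntangled d)

/-- `γ = (√F + √((d-1)(1-F))) / √d`. -/
def gammaCoeff (d : ℕ) (F : ℝ) : ℝ :=
  (1 / Real.sqrt d) * (Real.sqrt F + Real.sqrt (((d : ℝ) - 1) * (1 - F)))

/-- `δ = (√F - √(1-F) / √(d-1)) / √d`. -/
def deltaCoeff (d : ℕ) (F : ℝ) : ℝ :=
  (1 / Real.sqrt d) * (Real.sqrt F - Real.sqrt (1 - F) / Real.sqrt ((d : ℝ) - 1))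

/-- `ξ(F, q, s, d) = 1 - (γ^{2q} + (d-1) δ^{2q})^s`. -/
def xi (F q s : ℝ) (d : ℕ) : ℝ :=
  1 - (gammaCoeff d F ^ (2 * q) + ((d : ℝ) - 1) * deltaCoeff d F ^ (2 * q)) ^ s

/-- On `S`, the function `g` is the convex envelope of `f`: the largest convex function on `S`
that is bounded above by `f`. -/
def IsConvexEnvelopeOn (S : Set ℝ) (f g : ℝ → ℝ) : Prop :=
  ConvexOn ℝ S g ∧ (∀ x ∈ S, g x ≤ f x) ∧
    ∀ h : ℝ → ℝ, ConvexOn ℝ S h → (∀ x ∈ S, h x ≤ f x) → ∀ x ∈ S, h x ≤ g x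

end UnifiedConcurrence

end

/-! Write a unit vector as a matrix `M`, and let `λ` be the spectrum of `M Mᴴ`. Its overlap with
`Ψ⁺` is `|tr M|²/d ≤ (∑ √λ i)²/d`. Among unit vectors `√λ` with entry sum at least `√(dF)`, the
largest `∑ λ i ^ q` occurs at `(γ, δ, …, δ)`, so overlap at least `F` forces concurrence at least
`ξ(F)` (`sum_rpow_le`, `xi_le_pureConcurrence`).

In any decomposition of `ρ_F` the overlaps average to `F`, so Jensen's inequality, in
supporting-line form, bounds the average concurrence below by `h F` for every convex minorant `h` of
`ξ`. Overlaps up to `1/d` lie outside the domain; there nonnegativity of the concurrence suffices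
because `ξ(1/d) = 0` (`le_of_mem_decompositionValues`).

Conversely, averaging the states with matrix `δ I + (γ - δ)|v⟩⟨v|` over a finite projective 2-design
in `v` gives exactly `ρ_F`, and each has concurrence `ξ(F)` (`xi_mem_decompositionValues`). Since
`ρ_F` is affine in `F`, the convex roof is itself a convex minorant, hence the largest one. -/

namespace UnifiedConcurrence

open Matrix
open scoped ComplexOrder

/-! ### Extremal power sums -/

/-- Quadratic majorant of a power function on `[0, a]`, touching it at `b` and meeting it at `a`. -/
lemma exists_quadratic_majorant {p a b : ℝ} (hp : 2 ≤ p) (hb : 0 ≤ b) (hab : b < a) :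
    ∃ u v w : ℝ, v ≤ 0 ∧ (∀ x, 0 ≤ x → x ≤ a → x ^ p ≤ u + v * x + w * x ^ 2) ∧
      a ^ p = u + v * a + w * a ^ 2 ∧ b ^ p = u + v * b + w * b ^ 2 := by
  set m : ℝ := p * b ^ (p - 1) with hm
  -- Hermite interpolation: `m` matches the slope at `b`, and `w` then matches the value at `a`.
  set w : ℝ := (a ^ p - b ^ p - m * (a - b)) / (a - b) ^ 2 with hw
  have hne : (a - b) ≠ 0 := by linarith
  set g : ℝ → ℝ := fun x => x ^ p - (b ^ p + m * (x - b) + w * (x - b) ^ 2) with hg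
  set g' : ℝ → ℝ := fun x => p * x ^ (p - 1) - (m + 2 * w * (x - b)) with hg'
  have hd : ∀ x, HasDerivAt g (g' x) x := by
    intro x
    have h1 := Real.hasDerivAt_rpow_const (x := x) (p := p) (Or.inr (by linarith))
    have h2 : HasDerivAt (fun x : ℝ => b ^ p + m * (x - b) + w * (x - b) ^ 2)
        (m + 2 * w * (x - b)) x := by
      have h3 := (hasDerivAt_id' x).sub_const b
      refine (((h3.const_mul m).const_add (b ^ p)).add ((h3.pow 2).const_mul w)).congr_deriv ?_
      ring
    exact h1.sub h2
  have hgb : g b = 0 := by simp [hg]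
  have hga : g a = 0 := by simp only [hg, hw]; field_simp; ring
  have hgb' : g' b = 0 := by simp [hg', hm]
  have hconv : ConvexOn ℝ (Set.Ici 0) g' := by
    have h1 : ConvexOn ℝ (Set.Ici 0) (fun x : ℝ => p * x ^ (p - 1)) :=
      (convexOn_rpow (by linarith)).smul (by linarith : (0 : ℝ) ≤ p)
    have h2 : ConcaveOn ℝ (Set.Ici 0) (fun x : ℝ => m + 2 * w * (x - b)) := by
      refine ⟨convex_Ici 0, fun x _ y _ s t _ _ hst => le_of_eq ?_⟩
      simp only [smul_eq_mul]
      linear_combination (m - 2 * w * b) * hst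
    exact h1.sub h2
  -- Rolle gives a second zero `e` of the convex function `g'`. Its signs are therefore `+, -, +` on
  -- the pieces cut by `b` and `e`, so the maximum of `g` on `[0, a]` is attained at `b` or `a`,
  -- where `g = 0`.
  obtain ⟨e, ⟨hbe, hea⟩, he⟩ := exists_hasDerivAt_eq_zero hab
    (fun x _ => (hd x).continuousAt.continuousWithinAt) (hgb.trans hga.symm) fun x _ => hd x
  have hlow : ∀ x, 0 ≤ x → x ≤ b → 0 ≤ g' x := by
    intro x hx hxb
    rcases hxb.eq_or_lt with rfl | hlt
    · exact hgb'.ge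
    have := hconv.slope_mono_adjacent hx (show (0:ℝ) ≤ e by linarith) hlt hbe
    rw [he, hgb', sub_zero, zero_div, div_le_iff₀ (by linarith)] at this
    linarith
  have hmid : ∀ x, b ≤ x → x ≤ e → g' x ≤ 0 := by
    intro x hx hxe
    have := hconv.le_max_of_mem_Icc hb (show (0:ℝ) ≤ e by linarith) ⟨hx, hxe⟩
    rwa [he, hgb', max_self] at this
  have hhigh : ∀ x, e ≤ x → 0 ≤ g' x := by
    intro x hx
    rcases hx.eq_or_lt with rfl | hlt
    · exact he.ge
    have := hconv.slope_mono_adjacent hb (show (0:ℝ) ≤ x by linarith) hbe hlt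
    rw [he, hgb', sub_zero, zero_div, le_div_iff₀ (by linarith)] at this
    linarith
  have hcont : ∀ s : Set ℝ, ContinuousOn g s :=
    fun s x _ => (hd x).continuousAt.continuousWithinAt
  have hmono1 : MonotoneOn g (Set.Icc 0 b) :=
    monotoneOn_of_hasDerivWithinAt_nonneg (convex_Icc _ _) (hcont _)
      (fun x _ => (hd x).hasDerivWithinAt) fun x hx => by
        rw [interior_Icc] at hx; exact hlow x hx.1.le hx.2.le
  have hanti : AntitoneOn g (Set.Icc b e) :=
    antitoneOn_of_hasDerivWithinAt_nonpos (convex_Icc _ _) (hcont _)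
      (fun x _ => (hd x).hasDerivWithinAt) fun x hx => by
        rw [interior_Icc] at hx; exact hmid x hx.1.le hx.2.le
  have hmono2 : MonotoneOn g (Set.Ici e) :=
    monotoneOn_of_hasDerivWithinAt_nonneg (convex_Ici _) (hcont _)
      (fun x _ => (hd x).hasDerivWithinAt) fun x hx => by
        rw [interior_Ici] at hx; exact hhigh x (le_of_lt hx)
  have hle : ∀ x, 0 ≤ x → x ≤ a → g x ≤ 0 := by
    intro x hx hxa
    rcases le_total x b with h | h
    · exact hgb ▸ hmono1 ⟨hx, h⟩ ⟨hb, le_rfl⟩ h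
    rcases le_total x e with h' | h'
    · exact hgb ▸ hanti ⟨le_rfl, hbe.le⟩ ⟨h, h'⟩ h
    · exact hga ▸ hmono2 h' hea.le hxa
  refine ⟨b ^ p - m * b + w * b ^ 2, m - 2 * w * b, w, ?_, ?_, ?_, ?_⟩
  -- The linear coefficient is `-g' 0`, because `0 ^ (p - 1) = 0`.
  · have := hlow 0 le_rfl hb
    simp only [hg', Real.zero_rpow (show p - 1 ≠ 0 by linarith)] at this
    linarith
  · intro x hx hxa
    have := hle x hx hxa
    simp only [hg] at this
    linarith
  · simp only [hg] at hga
    linarith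
  · ring

/-- Among nonnegative families with prescribed sum of squares and a lower bound on the sum, the sum
of `p`-th powers, `p ≥ 2`, is largest when all entries but the largest one agree. -/
lemma sum_rpow_le {ι : Type*} [Fintype ι] {p a b : ℝ} (hp : 2 ≤ p) (hb : 0 ≤ b)
    (hab : b ≤ a) (x : ι → ℝ) (hx : ∀ i, 0 ≤ x i)
    (h2 : ∑ i, x i ^ 2 = a ^ 2 + ((Fintype.card ι : ℝ) - 1) * b ^ 2)
    (h1 : a + ((Fintype.card ι : ℝ) - 1) * b ≤ ∑ i, x i) :
    ∑ i, x i ^ p ≤ a ^ p + ((Fintype.card ι : ℝ) - 1) * b ^ p := by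
  classical
  -- The constraints give `∑_{j ≠ i} (x j - b)² ≤ (a - b)² - (x i - b)²`, which would be negative if
  -- `x i > a`.
  have hxa : ∀ i, x i ≤ a := by
    intro i
    by_contra! hlt
    have hs : 0 ≤ ∑ j ∈ Finset.univ.erase i, (x j - b) ^ 2 :=
      Finset.sum_nonneg fun _ _ => sq_nonneg _
    have he : ∑ j ∈ Finset.univ.erase i, (x j - b) ^ 2 =
        (∑ j, x j ^ 2) - 2 * b * ∑ j, x j + Fintype.card ι * b ^ 2 - (x i - b) ^ 2 := by
      rw [eq_sub_iff_add_eq, Finset.sum_erase_add _ _ (Finset.mem_univ i)]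
      simp only [sub_sq, Finset.sum_add_distrib, Finset.sum_sub_distrib, Finset.sum_const,
        Finset.card_univ, nsmul_eq_mul, Finset.mul_sum]
      congr 2
      exact Finset.sum_congr rfl fun j _ => by ring
    rw [he, h2] at hs
    nlinarith [mul_le_mul_of_nonneg_left h1 hb,
      mul_pos (sub_pos.2 hlt) (show 0 < a + x i - 2 * b by linarith)]
  rcases hab.eq_or_lt with rfl | hlt
  · calc ∑ i, x i ^ p = ∑ i, x i ^ 2 * x i ^ (p - 2) := by
          refine Finset.sum_congr rfl fun i _ => ?_
          rw [← Real.rpow_natCast, ← Real.rpow_add_of_nonneg (hx i) (by norm_num) (by linarith)]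
          norm_num
      _ ≤ ∑ i, x i ^ 2 * b ^ (p - 2) := by
          gcongr with i
          · exact hx i
          · exact hxa i
      _ = b ^ p + ((Fintype.card ι : ℝ) - 1) * b ^ p := by
          have : b ^ p = b ^ 2 * b ^ (p - 2) := by
            rw [← Real.rpow_natCast b 2, ← Real.rpow_add_of_nonneg hb (by norm_num) (by linarith)]
            norm_num
          rw [← Finset.sum_mul, h2, this]; ring
  -- The majorant only sees `∑ x i` and `∑ x i ^ 2`; as `v ≤ 0`, a lower bound on the former is
  -- enough.
  · obtain ⟨u, v, w, hv, hle, ha', hb'⟩ := exists_quadratic_majorant hp hb hlt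
    calc ∑ i, x i ^ p ≤ ∑ i, (u + v * x i + w * x i ^ 2) :=
          Finset.sum_le_sum fun i _ => hle _ (hx i) (hxa i)
      _ = Fintype.card ι * u + v * ∑ i, x i + w * ∑ i, x i ^ 2 := by
          simp [Finset.sum_add_distrib, Finset.mul_sum]
      _ ≤ _ := by
          rw [h2, ha', hb']
          nlinarith [mul_le_mul_of_nonpos_left h1 hv]

/-! ### The coefficients `γ` and `δ` -/

section Coefficients

variable {d : ℕ} {F : ℝ}

lemma deltaCoeff_nonneg (hd : 2 ≤ d) (hF : 1 / (d : ℝ) ≤ F) : 0 ≤ deltaCoeff d F := by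
  have hd' : (2 : ℝ) ≤ d := by exact_mod_cast hd
  have h : √(1 - F) / √((d : ℝ) - 1) ≤ √F := by
    rw [← Real.sqrt_div' _ (by linarith)]
    apply Real.sqrt_le_sqrt
    rw [div_le_iff₀ (by linarith)] at hF ⊢
    linarith
  unfold deltaCoeff
  have : 0 ≤ 1 / √(d : ℝ) := by positivity
  exact mul_nonneg this (sub_nonneg.2 h)

lemma gammaCoeff_nonneg : 0 ≤ gammaCoeff d F := by
  unfold gammaCoeff; positivity

lemma gammaCoeff_sub_deltaCoeff (hd : 2 ≤ d) :
    gammaCoeff d F - deltaCoeff d F = √d * (√(1 - F) / √((d : ℝ) - 1)) := by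
  have hd' : (2 : ℝ) ≤ d := by exact_mod_cast hd
  have h1 : √((d : ℝ) - 1) ≠ 0 := (Real.sqrt_pos.2 (by linarith)).ne'
  have h2 : √(d : ℝ) ≠ 0 := (Real.sqrt_pos.2 (by linarith)).ne'
  unfold gammaCoeff deltaCoeff
  rw [Real.sqrt_mul (by linarith)]
  have h3 : √((d : ℝ) - 1) ^ 2 = d - 1 := Real.sq_sqrt (by linarith)
  have h4 : √(d : ℝ) ^ 2 = d := Real.sq_sqrt (by linarith)
  field_simp
  linear_combination √(1 - F) * h3 - √(1 - F) * h4

lemma deltaCoeff_le_gammaCoeff (hd : 2 ≤ d) : deltaCoeff d F ≤ gammaCoeff d F := by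
  have := gammaCoeff_sub_deltaCoeff (F := F) hd
  have h : 0 ≤ √d * (√(1 - F) / √((d : ℝ) - 1)) := by positivity
  linarith

/-- Together with the normalization below, this makes `(γ, δ, …, δ)` the Schmidt coefficients of a
state with overlap exactly `F`. -/
lemma gammaCoeff_add_mul_deltaCoeff (hd : 2 ≤ d) :
    gammaCoeff d F + ((d : ℝ) - 1) * deltaCoeff d F = √d * √F := by
  have hd' : (2 : ℝ) ≤ d := by exact_mod_cast hd
  have h1 : √((d : ℝ) - 1) ≠ 0 := (Real.sqrt_pos.2 (by linarith)).ne'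
  have h2 : √(d : ℝ) ≠ 0 := (Real.sqrt_pos.2 (by linarith)).ne'
  have h3 : √((d : ℝ) - 1) ^ 2 = d - 1 := Real.sq_sqrt (by linarith)
  have h4 : √(d : ℝ) ^ 2 = d := Real.sq_sqrt (by linarith)
  unfold gammaCoeff deltaCoeff
  rw [Real.sqrt_mul (by linarith)]
  field_simp
  rw [h4]
  linear_combination √(1 - F) * h3

lemma sq_gammaCoeff_add_mul_sq_deltaCoeff (hd : 2 ≤ d) (hF0 : 0 ≤ F) (hF1 : F ≤ 1) :
    gammaCoeff d F ^ 2 + ((d : ℝ) - 1) * deltaCoeff d F ^ 2 = 1 := by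
  have hd' : (2 : ℝ) ≤ d := by exact_mod_cast hd
  have h1 : √((d : ℝ) - 1) ≠ 0 := (Real.sqrt_pos.2 (by linarith)).ne'
  have h2 : √(d : ℝ) ≠ 0 := (Real.sqrt_pos.2 (by linarith)).ne'
  have h3 : √((d : ℝ) - 1) ^ 2 = d - 1 := Real.sq_sqrt (by linarith)
  have h4 : √(d : ℝ) ^ 2 = d := Real.sq_sqrt (by linarith)
  have h5 : √F ^ 2 = F := Real.sq_sqrt hF0
  have h6 : √(1 - F) ^ 2 = 1 - F := Real.sq_sqrt (by linarith)
  unfold gammaCoeff deltaCoeff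
  rw [Real.sqrt_mul (by linarith)]
  have e : (1 / √(d : ℝ)) ^ 2 = 1 / d := by rw [div_pow, h4, one_pow]
  rw [mul_pow, mul_pow, e]
  have e2 : ((d : ℝ) - 1) * (√F - √(1 - F) / √((d : ℝ) - 1)) ^ 2 =
      (√((d : ℝ) - 1) * √F - √(1 - F)) ^ 2 := by
    conv_lhs => rw [← h3]
    rw [← mul_pow]
    congr 1
    rw [h3]
    field_simp
  have : (d : ℝ) ≠ 0 := by linarith
  have e3 : (√F + √((d : ℝ) - 1) * √(1 - F)) ^ 2 + (√((d : ℝ) - 1) * √F - √(1 - F)) ^ 2 = d := by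
    linear_combination (1 + √((d : ℝ) - 1) ^ 2) * (h5 + h6) + h3
  calc _ = 1 / (d : ℝ) * ((√F + √((d : ℝ) - 1) * √(1 - F)) ^ 2 +
        ((d : ℝ) - 1) * (√F - √(1 - F) / √((d : ℝ) - 1)) ^ 2) := by ring
    _ = 1 := by rw [e2, e3]; field_simp

/-- At this endpoint `γ = 1` and `δ = 0`, as for a product state. The value controls convex
minorants near the excluded endpoint. -/
lemma xi_one_div {q s : ℝ} (hd : 2 ≤ d) (hq : 1 ≤ q) : xi (1 / (d : ℝ)) q s d = 0 := by
  have hd' : (2 : ℝ) ≤ d := by exact_mod_cast hd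
  have h2 := gammaCoeff_add_mul_deltaCoeff (F := 1 / (d : ℝ)) hd
  have h1 := gammaCoeff_sub_deltaCoeff (F := 1 / (d : ℝ)) hd
  rw [← Real.sqrt_mul (by linarith), mul_one_div_cancel (by linarith), Real.sqrt_one] at h2
  rw [← Real.sqrt_div' _ (by linarith), ← Real.sqrt_mul (by linarith),
    show (d : ℝ) * ((1 - 1 / d) / (d - 1)) = 1 by
      have : (d : ℝ) - 1 ≠ 0 := by linarith
      field_simp, Real.sqrt_one] at h1
  have hδ : deltaCoeff d (1 / (d : ℝ)) = 0 := by
    have : (d : ℝ) * deltaCoeff d (1 / (d : ℝ)) = 0 := by linarith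
    rcases mul_eq_zero.1 this with h | h
    · linarith
    · exact h
  have hγ : gammaCoeff d (1 / (d : ℝ)) = 1 := by linarith
  rw [xi, hδ, hγ, Real.zero_rpow (show 2 * q ≠ 0 by linarith)]
  simp

lemma continuous_xi {q s : ℝ} (hq : 0 ≤ q) (hs : 0 ≤ s) : Continuous fun F => xi F q s d := by
  have h1 : Continuous fun F => gammaCoeff d F := by unfold gammaCoeff; fun_prop
  have h2 : Continuous fun F => deltaCoeff d F := by unfold deltaCoeff; fun_prop
  unfold xi
  have h3 := h1.rpow_const (p := 2 * q) fun _ => Or.inr (by linarith)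
  have h4 := h2.rpow_const (p := 2 * q) fun _ => Or.inr (by linarith)
  exact continuous_const.sub ((h3.add (continuous_const.mul h4)).rpow_const fun _ => Or.inr hs)

end Coefficients

/-- Supporting line of a convex function at an interior point. -/
lemma exists_supporting_line {S : Set ℝ} {f : ℝ → ℝ} (hf : ConvexOn ℝ S f) {x : ℝ}
    (hx : x ∈ interior S) : ∃ m : ℝ, ∀ y ∈ S, f x + m * (y - x) ≤ f y := by
  refine ⟨derivWithin f (Set.Ioi x) x, fun y hy => ?_⟩
  rcases lt_trichotomy y x with h | rfl | h
  · have h1 := (hf.slope_le_leftDeriv_of_mem_interior hy hx h).trans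
      (hf.leftDeriv_le_rightDeriv_of_mem_interior hx)
    rw [slope_def_field, div_le_iff₀ (by linarith)] at h1
    linarith
  · simp
  · have h1 := hf.rightDeriv_le_slope_of_mem_interior hx hy h
    rw [slope_def_field, le_div_iff₀ (by linarith)] at h1
    linarith

/-! ### Reduced spectra and pure state concurrence -/

section General

variable {m n : Type*}

/-- The coefficient matrix of a bipartite vector. -/
def coeffMatrix (ψ : Bipartite m n) : Matrix m n ℂ := Matrix.of fun i k => ψ (i, k)

lemma reducedA_eq [Fintype n] (ψ : Bipartite m n) :
    reducedA ψ = coeffMatrix ψ * (coeffMatrix ψ)ᴴ := by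
  ext i j
  simp [reducedA, partialTraceB, ketBra, coeffMatrix, Matrix.mul_apply, Matrix.vecMulVec_apply]

lemma posSemidef_reducedA [Fintype m] [Fintype n] (ψ : Bipartite m n) :
    (reducedA ψ).PosSemidef := by
  rw [reducedA_eq]; exact Matrix.posSemidef_self_mul_conjTranspose _

lemma trace_reducedA [Fintype m] [Fintype n] (ψ : Bipartite m n) :
    (reducedA ψ).trace = ((‖ψ‖ ^ 2 : ℝ) : ℂ) := by
  simp only [EuclideanSpace.norm_sq_eq, Fintype.sum_prod_type, reducedA, partialTraceB, ketBra,
    Matrix.trace, Matrix.diag_apply, Matrix.of_apply, Matrix.vecMulVec_apply, Pi.star_apply,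
    Complex.ofReal_sum]
  refine Finset.sum_congr rfl fun i _ => Finset.sum_congr rfl fun k _ => ?_
  rw [Complex.star_def, Complex.mul_conj, Complex.normSq_eq_norm_sq]

lemma trPow_eq_sum_eigenvalues [Fintype m] [DecidableEq m] {A : Matrix m m ℂ}
    (hA : A.IsHermitian) (q : ℝ) : trPow A q = ∑ i, hA.eigenvalues i ^ q := by
  rw [trPow, hA.cfc_eq, Matrix.IsHermitian.cfc, Unitary.conjStarAlgAut_apply,
    Matrix.trace_mul_comm, ← mul_assoc, Unitary.coe_star_mul_self, one_mul]
  simp [Matrix.trace]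

variable [Fintype m] [DecidableEq m] [Fintype n]

lemma sum_eigenvalues_reducedA {ψ : Bipartite m n} (hψ : ‖ψ‖ = 1) :
    ∑ i, (posSemidef_reducedA ψ).1.eigenvalues i = 1 := by
  have h := (posSemidef_reducedA ψ).1.trace_eq_sum_eigenvalues
  rw [trace_reducedA, hψ] at h
  have h' := congrArg Complex.re h
  simpa using h'.symm

lemma pureConcurrence_eq {q s : ℝ} (hq : 1 ≤ q) (hqs : 1 ≤ q * s) (ψ : Bipartite m n) :
    pureConcurrence q s ψ = 1 - (∑ i, (posSemidef_reducedA ψ).1.eigenvalues i ^ q) ^ s := by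
  rw [pureConcurrence, signFactor, if_pos ⟨hq, hqs⟩, one_mul,
    trPow_eq_sum_eigenvalues (posSemidef_reducedA ψ).1]

/-- The eigenvalues lie in `[0, 1]` and sum to one, and `λ ^ q ≤ λ` there. -/
lemma pureConcurrence_nonneg {q s : ℝ} (hq : 1 ≤ q) (hqs : 1 ≤ q * s) {ψ : Bipartite m n}
    (hψ : ‖ψ‖ = 1) : 0 ≤ pureConcurrence q s ψ := by
  have h0 := (posSemidef_reducedA ψ).eigenvalues_nonneg
  have hsum := sum_eigenvalues_reducedA hψ
  have hs : 0 ≤ s := by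
    by_contra! h
    nlinarith
  rw [pureConcurrence_eq hq hqs, sub_nonneg]
  refine Real.rpow_le_one (Finset.sum_nonneg fun i _ => Real.rpow_nonneg (h0 i) _) ?_ hs
  rw [← hsum]
  refine Finset.sum_le_sum fun i _ => ?_
  have h1 : (posSemidef_reducedA ψ).1.eigenvalues i ≤ 1 :=
    hsum ▸ Finset.single_le_sum (fun j _ => h0 j) (Finset.mem_univ i)
  simpa using Real.rpow_le_rpow_of_exponent_ge' (h0 i) h1 zero_le_one hq

/-- The modulus of the trace is at most the sum of the singular values. -/
lemma norm_trace_le_sum_sqrt_eigenvalues (M : Matrix m m ℂ) :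
    ‖M.trace‖ ≤ ∑ i, √((Matrix.isHermitian_mul_conjTranspose_self M).eigenvalues i) := by
  set hA := Matrix.isHermitian_mul_conjTranspose_self M
  set U : Matrix m m ℂ := hA.eigenvectorUnitary.1 with hU
  have hUU : U * star U = 1 := Unitary.coe_mul_star_self _
  -- In an eigenbasis of `M Mᴴ` the rows of `N` have squared norms equal to the eigenvalues, and
  -- each row norm dominates the diagonal entry.
  set N : Matrix m m ℂ := star U * M * U with hN
  have htr : M.trace = N.trace := by
    rw [hN, Matrix.trace_mul_comm, ← mul_assoc, hUU, one_mul]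
  have hNN : N * Nᴴ = Matrix.diagonal (RCLike.ofReal ∘ hA.eigenvalues) := by
    rw [← hA.conjStarAlgAut_star_eigenvectorUnitary, Unitary.conjStarAlgAut_apply]
    simp only [hN, ← Matrix.star_eq_conjTranspose, star_mul, star_star, Unitary.coe_star]
    calc star U * M * U * (star U * (star M * U))
        = star U * M * (U * star U) * star M * U := by simp only [mul_assoc]
      _ = _ := by rw [hUU, mul_one]; simp only [mul_assoc, hU]
  rw [htr]
  refine (norm_sum_le _ _).trans (Finset.sum_le_sum fun i _ => ?_)
  apply Real.le_sqrt_of_sq_le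
  have hi := congrArg Complex.re (congrFun (congrFun hNN i) i)
  simp only [Matrix.mul_apply, Matrix.conjTranspose_apply, Matrix.diagonal_apply_eq,
    Complex.star_def, Complex.mul_conj, Complex.re_sum, Complex.ofReal_re, Function.comp_apply,
    Complex.normSq_eq_norm_sq] at hi
  have : (∑ k, ‖N i k‖ ^ 2) = hA.eigenvalues i := by simpa using hi
  rw [← this, Matrix.diag_apply]
  exact Finset.single_le_sum (f := fun k => ‖N i k‖ ^ 2) (fun k _ => sq_nonneg _)
    (Finset.mem_univ i)

end General

/-! ### Overlap with the maximally entangled state and the lower bound -/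

variable {d : ℕ}

/-- The overlap `⟨Ψ⁺|ρ|Ψ⁺⟩`. -/
noncomputable def fidelity (d : ℕ) : Matrix (Fin d × Fin d) (Fin d × Fin d) ℂ →ₗ[ℂ] ℂ :=
  (1 / d : ℂ) • ∑ i, ∑ j, Matrix.entryLinearMap ℂ ℂ (i, i) (j, j)

lemma fidelity_apply (ρ : Matrix (Fin d × Fin d) (Fin d × Fin d) ℂ) :
    fidelity d ρ = (1 / d : ℂ) * ∑ i, ∑ j, ρ (i, i) (j, j) := by
  simp [fidelity]

lemma fidelity_ketBra (ψ : Bipartite (Fin d) (Fin d)) :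
    fidelity d (ketBra ψ) = ((‖(coeffMatrix ψ).trace‖ ^ 2 / d : ℝ) : ℂ) := by
  have : ∑ i, ∑ j, ketBra ψ (i, i) (j, j) =
      (coeffMatrix ψ).trace * star (coeffMatrix ψ).trace := by
    simp [ketBra, Matrix.vecMulVec_apply, Matrix.trace, coeffMatrix, Finset.sum_mul_sum]
  rw [fidelity_apply, this, Complex.star_def, Complex.mul_conj, Complex.normSq_eq_norm_sq]
  push_cast
  ring

lemma ketBra_maxEntangled_apply (i k j l : Fin d) :
    ketBra (maxEntangled d) (i, k) (j, l) = if i = k ∧ j = l then (1 / d : ℂ) else 0 := by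
  have h (i k : Fin d) : (maxEntangled d) (i, k) =
      if i = k then ((1 / √(d : ℝ) : ℝ) : ℂ) else 0 := by
    simp only [maxEntangled, PiLp.smul_apply, WithLp.ofLp_sum, Finset.sum_apply,
      PiLp.single_apply, Prod.mk.injEq, smul_eq_mul]
    by_cases hik : i = k
    · subst hik; simp
    · rw [Finset.sum_eq_zero, if_neg hik, mul_zero]
      rintro x -
      rw [if_neg]
      rintro ⟨rfl, rfl⟩
      exact hik rfl
  have h2 : ((1 / √(d : ℝ) : ℝ) : ℂ) * star ((1 / √(d : ℝ) : ℝ) : ℂ) = 1 / d := by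
    rw [Complex.star_def, Complex.conj_ofReal, ← Complex.ofReal_mul, ← sq, div_pow, one_pow,
      Real.sq_sqrt (Nat.cast_nonneg d)]
    simp
  simp only [ketBra, Matrix.vecMulVec_apply, Pi.star_apply]
  rw [h, h]
  by_cases h1 : i = k <;> by_cases h3 : j = l <;> simp only [h1, h3, and_true, and_false,
    if_true, if_false, h2, zero_mul, star_zero, mul_zero]

lemma isotropicState_apply (F : ℝ) (i k j l : Fin d) :
    isotropicState d F (i, k) (j, l) =
      (((1 - F) / ((d : ℝ) ^ 2 - 1) : ℝ) : ℂ) * (if i = j ∧ k = l then 1 else 0) +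
      ((F - (1 - F) / ((d : ℝ) ^ 2 - 1) : ℝ) : ℂ) * (if i = k ∧ j = l then (1 / d : ℂ) else 0) := by
  simp only [isotropicState, Matrix.add_apply, Matrix.smul_apply, Matrix.sub_apply,
    ketBra_maxEntangled_apply, Matrix.one_apply, Prod.mk.injEq, smul_eq_mul]
  push_cast
  ring

lemma fidelity_isotropicState (hd : 2 ≤ d) (F : ℝ) : fidelity d (isotropicState d F) = F := by
  have hd' : (2 : ℝ) ≤ d := by exact_mod_cast hd
  have h : ((d : ℝ) ^ 2 - 1) ≠ 0 := by nlinarith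
  have h1 : ∑ i : Fin d, ∑ j : Fin d, isotropicState d F (i, i) (j, j) =
      (((1 - F) / ((d : ℝ) ^ 2 - 1) * d + (F - (1 - F) / ((d : ℝ) ^ 2 - 1)) * d : ℝ) : ℂ) := by
    simp only [isotropicState_apply, and_self, if_true, Finset.sum_add_distrib, ← Finset.mul_sum,
      Finset.sum_ite_eq, Finset.mem_univ, Finset.sum_const, Finset.card_univ, Fintype.card_fin,
      nsmul_eq_mul]
    have : (d : ℂ) ≠ 0 := by exact_mod_cast (by omega : d ≠ 0)
    push_cast
    field_simp
  rw [fidelity_apply, h1]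
  have : (1 / d : ℂ) = ((1 / d : ℝ) : ℂ) := by push_cast; rfl
  rw [this, ← Complex.ofReal_mul]
  congr 1
  have : (d : ℝ) ≠ 0 := by linarith
  field_simp
  ring

/-- A pure state with overlap at least `F` has concurrence at least `ξ(F)`. -/
lemma xi_le_pureConcurrence {q s : ℝ} (hd : 2 ≤ d) (hq : 1 ≤ q) (hqs : 1 ≤ q * s)
    {ψ : Bipartite (Fin d) (Fin d)} (hψ : ‖ψ‖ = 1) {F : ℝ} (hF : 1 / (d : ℝ) ≤ F) (hF1 : F ≤ 1)
    (hFψ : F ≤ ‖(coeffMatrix ψ).trace‖ ^ 2 / d) : xi F q s d ≤ pureConcurrence q s ψ := by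
  have hd' : (2 : ℝ) ≤ d := by exact_mod_cast hd
  have hs : 0 ≤ s := by
    by_contra! h
    nlinarith
  have h0 := (posSemidef_reducedA ψ).eigenvalues_nonneg
  have hsum := sum_eigenvalues_reducedA hψ
  have hF0 : 0 ≤ F := le_trans (by positivity) hF
  have hδ := deltaCoeff_nonneg hd hF
  have hγ := gammaCoeff_nonneg (d := d) (F := F)
  rw [pureConcurrence_eq hq hqs, xi]
  refine sub_le_sub_left (Real.rpow_le_rpow
    (Finset.sum_nonneg fun i _ => Real.rpow_nonneg (h0 i) _) ?_ hs) _
  have htr : ‖(coeffMatrix ψ).trace‖ ≤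
      ∑ i, √((posSemidef_reducedA ψ).1.eigenvalues i) := by
    have := norm_trace_le_sum_sqrt_eigenvalues (coeffMatrix ψ)
    simpa only [reducedA_eq] using this
  have key := sum_rpow_le (p := 2 * q) (by linarith) hδ (deltaCoeff_le_gammaCoeff hd)
    (fun i => √((posSemidef_reducedA ψ).1.eigenvalues i)) (fun i => Real.sqrt_nonneg _)
    (by
      rw [Fintype.card_fin, sq_gammaCoeff_add_mul_sq_deltaCoeff hd hF0 hF1, ← hsum]
      exact Finset.sum_congr rfl fun i _ => Real.sq_sqrt (h0 i))
    (by
      rw [Fintype.card_fin, gammaCoeff_add_mul_deltaCoeff hd, ← Real.sqrt_mul (by linarith)]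
      refine le_trans ?_ htr
      rw [Real.sqrt_le_left (norm_nonneg _)]
      rw [le_div_iff₀ (by linarith)] at hFψ
      linarith)
  rw [Fintype.card_fin] at key
  refine le_trans (le_of_eq (Finset.sum_congr rfl fun i _ => ?_)) key
  rw [Real.rpow_mul (Real.sqrt_nonneg _), Real.rpow_two, Real.sq_sqrt (h0 i)]

/-- Overlaps of unit vectors with the maximally entangled state are at most one. -/
lemma norm_sq_trace_div_le_one {ψ : Bipartite (Fin d) (Fin d)} (hψ : ‖ψ‖ = 1) :
    ‖(coeffMatrix ψ).trace‖ ^ 2 / d ≤ 1 := by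
  apply div_le_one_of_le₀ _ (Nat.cast_nonneg d)
  have h1 : ‖(coeffMatrix ψ).trace‖ ^ 2 ≤ (∑ i, ‖ψ (i, i)‖) ^ 2 := by
    gcongr
    exact norm_sum_le _ _
  have h2 : (∑ i, ‖ψ (i, i)‖) ^ 2 ≤ d * ∑ i, ‖ψ (i, i)‖ ^ 2 := by
    simpa using sq_sum_le_card_mul_sum_sq (s := Finset.univ) (f := fun i => ‖ψ (i, i)‖)
  have h3 : ∑ i, ‖ψ (i, i)‖ ^ 2 ≤ 1 := by
    have : ‖ψ‖ ^ 2 = 1 := by rw [hψ, one_pow]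
    rw [← this, EuclideanSpace.norm_sq_eq, Fintype.sum_prod_type]
    exact Finset.sum_le_sum fun i _ =>
      Finset.single_le_sum (f := fun k => ‖ψ (i, k)‖ ^ 2) (fun k _ => sq_nonneg _)
        (Finset.mem_univ i)
  nlinarith [(Nat.cast_nonneg d : (0 : ℝ) ≤ d)]

/-- A convex minorant of `ξ` on `(1/d, 1]` bounds every decomposition of the isotropic state. -/
lemma le_of_mem_decompositionValues {q s : ℝ} (hd : 2 ≤ d) (hq : 1 ≤ q) (hqs : 1 ≤ q * s)
    {h : ℝ → ℝ} (hconv : ConvexOn ℝ (Set.Ioc (1 / (d : ℝ)) 1) h)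
    (hle : ∀ x ∈ Set.Ioc (1 / (d : ℝ)) 1, h x ≤ xi x q s d) {F : ℝ}
    (hF : F ∈ Set.Ioc (1 / (d : ℝ)) 1) {x : ℝ}
    (hx : x ∈ decompositionValues q s (isotropicState d F)) : h F ≤ x := by
  obtain ⟨N, p, ψ, hp, hp1, hψ, hρ, rfl⟩ := hx
  have hd' : (2 : ℝ) ≤ d := by exact_mod_cast hd
  have hs : 0 ≤ s := by
    by_contra! h
    nlinarith
  set f : Fin N → ℝ := fun i => ‖(coeffMatrix (ψ i)).trace‖ ^ 2 / d with hf
  have hf1 : ∀ i, f i ≤ 1 := fun i => norm_sq_trace_div_le_one (hψ i)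
  have hC0 : ∀ i, 0 ≤ pureConcurrence q s (ψ i) := fun i => pureConcurrence_nonneg hq hqs (hψ i)
  have hsum : F = ∑ i, p i * f i := by
    have e := fidelity_isotropicState hd F
    rw [hρ, map_sum] at e
    simp only [map_smul, fidelity_ketBra, smul_eq_mul] at e
    exact_mod_cast e.symm
  have hC : ∀ i, 1 / (d : ℝ) < f i → h (f i) ≤ pureConcurrence q s (ψ i) := fun i hi =>
    (hle _ ⟨hi, hf1 i⟩).trans (xi_le_pureConcurrence hd hq hqs (hψ i) hi.le (hf1 i) le_rfl)
  rcases le_or_gt (h F) 0 with h0 | h0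
  · exact h0.trans (Finset.sum_nonneg fun i _ => mul_nonneg (hp i) (hC0 i))
  -- At the endpoint `1` no supporting line is available; instead, overlaps at most one with mean
  -- one must equal one wherever the weight is nonzero.
  rcases hF.2.eq_or_lt with rfl | hlt
  · have hz : ∀ i, p i * (1 - f i) = 0 := by
      have : ∑ i, p i * (1 - f i) = 0 := by
        simp only [mul_sub, mul_one, Finset.sum_sub_distrib, hp1, ← hsum, sub_self]
      intro i
      exact (Finset.sum_eq_zero_iff_of_nonneg
        fun i _ => mul_nonneg (hp i) (sub_nonneg.2 (hf1 i))).1 this i (Finset.mem_univ i)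
    calc h 1 = ∑ i, p i * h 1 := by rw [← Finset.sum_mul, hp1, one_mul]
      _ ≤ _ := Finset.sum_le_sum fun i _ => by
        rcases mul_eq_zero.1 (hz i) with hi | hi
        · simp [hi]
        · have hi' : f i = 1 := by linarith
          have := hC i (hi' ▸ hF.1)
          rw [hi'] at this
          exact mul_le_mul_of_nonneg_left this (hp i)
  · obtain ⟨m, hm⟩ := exists_supporting_line hconv (x := F) (by
      rw [interior_Ioc]; exact ⟨hF.1, hlt⟩)
    -- Let `y` decrease to `1/d` in `h F + m (y - F) ≤ h y ≤ ξ(y)`.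
    have hlim : h F + m * (1 / d - F) ≤ 0 := by
      have t1 : Filter.Tendsto (fun y => h F + m * (y - F)) (nhdsWithin (1 / (d : ℝ)) (Set.Ioi (1 / (d : ℝ))))
          (nhds (h F + m * (1 / d - F))) :=
        (Continuous.tendsto (by fun_prop) _).mono_left nhdsWithin_le_nhds
      have t2 : Filter.Tendsto (fun y => xi y q s d) (nhdsWithin (1 / (d : ℝ)) (Set.Ioi (1 / (d : ℝ))))
          (nhds (xi (1 / (d : ℝ)) q s d)) :=
        ((continuous_xi (by linarith) hs).tendsto _).mono_left nhdsWithin_le_nhds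
      rw [xi_one_div hd hq] at t2
      refine le_of_tendsto_of_tendsto t1 t2 ?_
      filter_upwards [Ioc_mem_nhdsGT (hF.1.trans_le hF.2)] with y hy
      exact (hm y hy).trans (hle y hy)
    -- The line is positive at `F` and nonpositive at `1/d`. Being nondecreasing, it stays
    -- nonpositive at every overlap up to `1/d`.
    have hm0 : 0 ≤ m := by
      by_contra! hm0
      nlinarith [hF.1]
    calc h F = ∑ i, p i * (h F + m * (f i - F)) := by
          simp only [mul_add, mul_sub, Finset.sum_add_distrib, Finset.sum_sub_distrib,
            ← Finset.sum_mul, hp1]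
          have : ∑ i, p i * (m * f i) = m * F := by
            rw [hsum, Finset.mul_sum]
            exact Finset.sum_congr rfl fun i _ => by ring
          rw [this]; ring
      _ ≤ _ := Finset.sum_le_sum fun i _ => mul_le_mul_of_nonneg_left (by
        rcases le_or_gt (f i) (1 / d) with hi | hi
        · refine le_trans ?_ (hC0 i)
          nlinarith
        · exact (hm _ ⟨hi, hf1 i⟩).trans (hC i hi)) (hp i)

/-! ### Convexity of the convex roof -/

/-- Arbitrary finite index types allow decompositions indexed by a sum type, both for concatenation
and for the 2-design. -/
lemma mem_decompositionValues {m n ι : Type*} [Fintype m] [DecidableEq m] [Fintype n] [Fintype ι]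
    {q s : ℝ} {ρ : Matrix (m × n) (m × n) ℂ} (p : ι → ℝ) (ψ : ι → Bipartite m n)
    (hp : ∀ i, 0 ≤ p i) (hp1 : ∑ i, p i = 1) (hψ : ∀ i, ‖ψ i‖ = 1)
    (hρ : ρ = ∑ i, (p i : ℂ) • ketBra (ψ i)) :
    ∑ i, p i * pureConcurrence q s (ψ i) ∈ decompositionValues q s ρ := by
  let e := (Fintype.equivFin ι).symm
  refine ⟨Fintype.card ι, p ∘ e, ψ ∘ e, fun i => hp _, ?_, fun i => hψ _, ?_, ?_⟩
  · rw [← hp1]; exact e.sum_comp p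
  · rw [hρ]; exact (e.sum_comp fun i => (p i : ℂ) • ketBra (ψ i)).symm
  · exact (e.sum_comp fun i => p i * pureConcurrence q s (ψ i)).symm

lemma decompositionValues_nonneg {m n : Type*} [Fintype m] [DecidableEq m] [Fintype n]
    {q s : ℝ} (hq : 1 ≤ q) (hqs : 1 ≤ q * s) {ρ : Matrix (m × n) (m × n) ℂ} {x : ℝ}
    (hx : x ∈ decompositionValues q s ρ) : 0 ≤ x := by
  obtain ⟨N, p, ψ, hp, -, hψ, -, rfl⟩ := hx
  exact Finset.sum_nonneg fun i _ => mul_nonneg (hp i) (pureConcurrence_nonneg hq hqs (hψ i))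

/-- Convexity of the convex roof. -/
lemma concurrence_combo_le {m n : Type*} [Fintype m] [DecidableEq m] [Fintype n]
    {q s : ℝ} (hq : 1 ≤ q) (hqs : 1 ≤ q * s) {ρ σ : Matrix (m × n) (m × n) ℂ}
    (hρ : (decompositionValues q s ρ).Nonempty) (hσ : (decompositionValues q s σ).Nonempty)
    {a b : ℝ} (ha : 0 ≤ a) (hb : 0 ≤ b) (hab : a + b = 1) :
    concurrence q s ((a : ℂ) • ρ + (b : ℂ) • σ) ≤ a * concurrence q s ρ + b * concurrence q s σ := by
  have key : ∀ x ∈ decompositionValues q s ρ, ∀ y ∈ decompositionValues q s σ,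
      concurrence q s ((a : ℂ) • ρ + (b : ℂ) • σ) ≤ a * x + b * y := by
    rintro x ⟨N, p, ψ, hp, hp1, hψ, hρ, rfl⟩ y ⟨N', p', ψ', hp', hp1', hψ', hρ', rfl⟩
    refine csInf_le ⟨0, fun z hz => decompositionValues_nonneg hq hqs hz⟩ ?_
    have := mem_decompositionValues (q := q) (s := s) (ρ := (a : ℂ) • ρ + (b : ℂ) • σ)
      (Sum.elim (fun i => a * p i) fun i => b * p' i) (Sum.elim ψ ψ')
      (by rintro (i | i); exacts [mul_nonneg ha (hp i), mul_nonneg hb (hp' i)])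
      (by simp [← Finset.mul_sum, hp1, hp1', hab])
      (by rintro (i | i); exacts [hψ i, hψ' i])
      (by simp [hρ, hρ', Finset.smul_sum, smul_smul])
    simpa [Finset.mul_sum, mul_assoc] using this
  refine le_of_forall_pos_le_add fun ε hε => ?_
  obtain ⟨x, hx, hx'⟩ := Real.lt_sInf_add_pos hρ hε
  obtain ⟨y, hy, hy'⟩ := Real.lt_sInf_add_pos hσ hε
  refine (key x hx y hy).trans ?_
  have h1 := mul_le_mul_of_nonneg_left hx'.le ha
  have h2 := mul_le_mul_of_nonneg_left hy'.le hb
  unfold concurrence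
  nlinarith

lemma isotropicState_combo (d : ℕ) {a b : ℝ} (hab : a + b = 1) (F G : ℝ) :
    isotropicState d (a * F + b * G) =
      (a : ℂ) • isotropicState d F + (b : ℂ) • isotropicState d G := by
  have hb : b = 1 - a := by linarith
  subst hb
  ext ⟨i, k⟩ ⟨j, l⟩
  simp only [isotropicState_apply, Matrix.add_apply, Matrix.smul_apply, smul_eq_mul]
  push_cast
  ring

/-! ### Pure states attaining `ξ` -/

/-- The pure state with coefficient matrix `a I + (c - a) |v⟩⟨v|`. -/
def spikedState (a c : ℝ) (v : Fin d → ℂ) : Bipartite (Fin d) (Fin d) :=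
  WithLp.toLp 2 fun x => (if x.1 = x.2 then (a : ℂ) else 0) + ((c - a : ℝ) : ℂ) * (v x.1 * star (v x.2))

lemma coeffMatrix_spikedState (a c : ℝ) (v : Fin d → ℂ) :
    coeffMatrix (spikedState a c v) =
      (a : ℂ) • 1 + ((c - a : ℝ) : ℂ) • Matrix.vecMulVec v (star v) := by
  ext i k
  simp [coeffMatrix, spikedState, Matrix.one_apply, Matrix.vecMulVec_apply]

lemma vecMulVec_star_mul_self {v : Fin d → ℂ} (hv : v ⬝ᵥ star v = 1) :
    Matrix.vecMulVec v (star v) * Matrix.vecMulVec v (star v) = Matrix.vecMulVec v (star v) := by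
  rw [Matrix.vecMulVec_mul_vecMulVec, dotProduct_comm, hv, one_smul]

lemma reducedA_spikedState (a c : ℝ) {v : Fin d → ℂ} (hv : v ⬝ᵥ star v = 1) :
    reducedA (spikedState a c v) =
      ((a ^ 2 : ℝ) : ℂ) • 1 + ((c ^ 2 - a ^ 2 : ℝ) : ℂ) • Matrix.vecMulVec v (star v) := by
  have hP : (Matrix.vecMulVec v (star v))ᴴ = Matrix.vecMulVec v (star v) := by
    rw [Matrix.conjTranspose_vecMulVec, star_star]
  rw [reducedA_eq, coeffMatrix_spikedState, Matrix.conjTranspose_add, Matrix.conjTranspose_smul,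
    Matrix.conjTranspose_smul, hP, Matrix.conjTranspose_one]
  simp only [Complex.star_def, Complex.conj_ofReal, add_mul, mul_add, smul_mul_smul_comm, one_mul,
    mul_one, vecMulVec_star_mul_self hv]
  push_cast
  module

lemma trace_reducedA_spikedState (a c : ℝ) {v : Fin d → ℂ} (hv : v ⬝ᵥ star v = 1) :
    (reducedA (spikedState a c v)).trace = ((c ^ 2 + (d - 1) * a ^ 2 : ℝ) : ℂ) := by
  rw [reducedA_spikedState a c hv, Matrix.trace_add, Matrix.trace_smul, Matrix.trace_smul,
    Matrix.trace_vecMulVec, hv, Matrix.trace_one, Fintype.card_fin]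
  push_cast
  simp only [smul_eq_mul]
  ring

lemma norm_spikedState {a c : ℝ} {v : Fin d → ℂ} (hv : v ⬝ᵥ star v = 1)
    (hac : c ^ 2 + (d - 1) * a ^ 2 = 1) : ‖spikedState a c v‖ = 1 := by
  have h := trace_reducedA_spikedState a c hv
  rw [trace_reducedA, hac] at h
  have h' : ‖spikedState a c v‖ ^ 2 = 1 := by exact_mod_cast h
  exact (pow_eq_one_iff_of_nonneg (norm_nonneg _) two_ne_zero).1 h'

/-- The reduced matrix is annihilated by `(X - a²)(X - c²)`, so its eigenvalues are `a²` or `c²`. On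
these two points `x ^ q` agrees with an affine function, so the trace determines the power sum
without counting multiplicities. -/
lemma pureConcurrence_spikedState {q s a c : ℝ} (hq : 1 ≤ q) (hqs : 1 ≤ q * s) (ha : 0 ≤ a)
    (hc : 0 ≤ c) {v : Fin d → ℂ} (hv : v ⬝ᵥ star v = 1) :
    pureConcurrence q s (spikedState a c v) =
      1 - (c ^ (2 * q) + ((d : ℝ) - 1) * a ^ (2 * q)) ^ s := by
  set ψ := spikedState a c v
  set hA := (posSemidef_reducedA ψ).1
  have htr : ∑ i, hA.eigenvalues i = c ^ 2 + (d - 1) * a ^ 2 := by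
    have h := congrArg Complex.re hA.trace_eq_sum_eigenvalues
    rw [trace_reducedA_spikedState a c hv, Complex.ofReal_re, Complex.re_sum] at h
    exact h.symm
  have hroot : (reducedA ψ - ((a ^ 2 : ℝ) : ℂ) • 1) * (reducedA ψ - ((c ^ 2 : ℝ) : ℂ) • 1) = 0 := by
    rw [reducedA_spikedState a c hv]
    simp only [sub_mul, mul_sub, add_mul, mul_add, smul_mul_smul_comm, one_mul,
      mul_one, vecMulVec_star_mul_self hv]
    push_cast
    module
  have hev : ∀ i, hA.eigenvalues i = a ^ 2 ∨ hA.eigenvalues i = c ^ 2 := by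
    intro i
    have h1 := hA.mulVec_eigenvectorBasis i
    set u : Fin d → ℂ := ⇑(hA.eigenvectorBasis i)
    have hsub : ∀ r : ℝ, (reducedA ψ - (r : ℂ) • 1) *ᵥ u = ((hA.eigenvalues i - r : ℝ) : ℂ) • u := by
      intro r
      rw [Matrix.sub_mulVec, h1, Matrix.smul_mulVec, Matrix.one_mulVec]
      ext j
      simp [sub_mul]
    have h2 := congrArg (· *ᵥ u) hroot
    simp only [← Matrix.mulVec_mulVec, hsub, Matrix.mulVec_smul, Matrix.zero_mulVec] at h2
    have hu : u ≠ 0 := by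
      intro hu
      apply hA.eigenvectorBasis.orthonormal.ne_zero i
      ext j
      exact congrFun hu j
    rw [smul_smul, smul_eq_zero_iff_left hu, ← Complex.ofReal_mul, Complex.ofReal_eq_zero,
      mul_eq_zero, sub_eq_zero, sub_eq_zero] at h2
    exact h2.symm
  have hpow : ∀ x : ℝ, 0 ≤ x → (x ^ 2) ^ q = x ^ (2 * q) := fun x hx => by
    rw [Real.rpow_mul hx, Real.rpow_two]
  have hsum : ∑ i, hA.eigenvalues i ^ q = c ^ (2 * q) + ((d : ℝ) - 1) * a ^ (2 * q) := by
    rw [← hpow a ha, ← hpow c hc]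
    -- If `c² = a²` the quotient is `0` by convention, and the interpolation identity still holds.
    set t := ((c ^ 2) ^ q - (a ^ 2) ^ q) / (c ^ 2 - a ^ 2) with ht
    have hct : (c ^ 2) ^ q = (a ^ 2) ^ q + t * (c ^ 2 - a ^ 2) := by
      by_cases h : c ^ 2 - a ^ 2 = 0
      · rw [sub_eq_zero.1 h]; ring
      · rw [ht, div_mul_cancel₀ _ h]; ring
    have : ∀ i, hA.eigenvalues i ^ q = (a ^ 2) ^ q + t * (hA.eigenvalues i - a ^ 2) := by
      intro i
      rcases hev i with h | h <;> rw [h]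
      · ring
      · exact hct
    simp only [this, Finset.sum_add_distrib, ← Finset.mul_sum, Finset.sum_sub_distrib, htr,
      Finset.sum_const, Finset.card_univ, Fintype.card_fin, nsmul_eq_mul]
    rw [hct]; ring
  rw [pureConcurrence_eq hq hqs, hsum]

/-! ### A finite projective 2-design -/

/-- Powers of two form a Sidon set. Used as phase exponents, they make only the trivial coincidences
survive in the fourth moments. -/
lemma two_pow_add_two_pow_eq {i l j k : ℕ} (h : 2 ^ i + 2 ^ l = 2 ^ j + 2 ^ k) :
    (i = j ∧ k = l) ∨ (i = k ∧ j = l) := by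
  have aux : ∀ {i l j k : ℕ}, i ≤ l → j ≤ k → 2 ^ i + 2 ^ l = 2 ^ j + 2 ^ k → k ≤ l := by
    intro i l j k hil _ h
    by_contra! hlt
    have h1 : 2 ^ i ≤ 2 ^ l := Nat.pow_le_pow_right (by norm_num) hil
    have h2 : 2 ^ (l + 1) ≤ 2 ^ k := Nat.pow_le_pow_right (by norm_num) hlt
    have h3 : 0 < 2 ^ j := by positivity
    rw [pow_succ] at h2
    omega
  have main : ∀ {i l j k : ℕ}, i ≤ l → j ≤ k → 2 ^ i + 2 ^ l = 2 ^ j + 2 ^ k → i = j ∧ k = l := by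
    intro i l j k hil hjk h
    have hkl : k = l := le_antisymm (aux hil hjk h) (aux hjk hil h.symm)
    subst hkl
    exact ⟨Nat.pow_right_injective le_rfl (by simpa using h), rfl⟩
  rcases le_total i l with hil | hil <;> rcases le_total j k with hjk | hjk
  · exact Or.inl (main hil hjk h)
  · have := main hil hjk (h.trans (add_comm _ _)); tauto
  · have := main hil hjk ((add_comm _ _).trans h); omega
  · have := main hil hjk ((add_comm _ _).trans (h.trans (add_comm _ _))); omega

/-- Fourth moments of the phase vectors `t ↦ ζ ^ (t 2 ^ i)`. -/
lemma sum_phase_moments {ζ : ℂ} (hζ : IsPrimitiveRoot ζ (2 ^ (d + 1))) (i k j l : Fin d) :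
    ∑ t ∈ Finset.range (2 ^ (d + 1)), ζ ^ (t * 2 ^ (i : ℕ)) * star (ζ ^ (t * 2 ^ (k : ℕ))) *
      (star (ζ ^ (t * 2 ^ (j : ℕ))) * ζ ^ (t * 2 ^ (l : ℕ))) =
    if (i = j ∧ k = l) ∨ (i = k ∧ j = l) then 2 ^ (d + 1) else 0 := by
  have hnorm : ζ * star ζ = 1 := by
    rw [Complex.star_def, Complex.mul_conj, Complex.normSq_eq_norm_sq,
      hζ.norm'_eq_one (by positivity)]
    simp
  -- Each summand is the `t`-th power of one root of unity, so the sum is geometric.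
  have hterm : ∀ t : ℕ, ζ ^ (t * 2 ^ (i : ℕ)) * star (ζ ^ (t * 2 ^ (k : ℕ))) *
      (star (ζ ^ (t * 2 ^ (j : ℕ))) * ζ ^ (t * 2 ^ (l : ℕ))) =
      (ζ ^ (2 ^ (i : ℕ) + 2 ^ (l : ℕ)) * star ζ ^ (2 ^ (j : ℕ) + 2 ^ (k : ℕ))) ^ t := by
    intro t
    simp only [star_pow, mul_pow, ← pow_mul]
    ring
  simp only [hterm]
  split_ifs with h
  · have he : 2 ^ (i : ℕ) + 2 ^ (l : ℕ) = 2 ^ (j : ℕ) + 2 ^ (k : ℕ) := by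
      rcases h with ⟨rfl, rfl⟩ | ⟨rfl, rfl⟩
      · rfl
      · exact add_comm _ _
    rw [he, ← mul_pow, hnorm, one_pow]
    simp
  · set r := ζ ^ (2 ^ (i : ℕ) + 2 ^ (l : ℕ)) * star ζ ^ (2 ^ (j : ℕ) + 2 ^ (k : ℕ)) with hr
    have hr1 : r ≠ 1 := by
      intro h1
      have h2 : ζ ^ (2 ^ (i : ℕ) + 2 ^ (l : ℕ)) = ζ ^ (2 ^ (j : ℕ) + 2 ^ (k : ℕ)) := by
        calc _ = r * ζ ^ (2 ^ (j : ℕ) + 2 ^ (k : ℕ)) := by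
              rw [hr, mul_assoc, ← mul_pow, mul_comm (star ζ), hnorm, one_pow, mul_one]
          _ = _ := by rw [h1, one_mul]
      -- The order `2 ^ (d + 1)` of `ζ` exceeds every sum of two exponents, so no wraparound creates
      -- further coincidences.
      have hb : ∀ x y : Fin d, 2 ^ (x : ℕ) + 2 ^ (y : ℕ) < 2 ^ (d + 1) := by
        intro x y
        have hx : 2 ^ (x : ℕ) < 2 ^ d := Nat.pow_lt_pow_right (by norm_num) x.2
        have hy : 2 ^ (y : ℕ) < 2 ^ d := Nat.pow_lt_pow_right (by norm_num) y.2
        rw [pow_succ]; omega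
      have h3 := two_pow_add_two_pow_eq (hζ.pow_inj (hb i l) (hb j k) h2)
      simp only [Fin.val_inj] at h3
      exact h h3
    have hrN : r ^ (2 ^ (d + 1)) = 1 := by
      rw [hr, mul_pow, ← pow_mul, ← pow_mul, mul_comm _ (2 ^ (d + 1)), mul_comm _ (2 ^ (d + 1)),
        pow_mul, pow_mul, ← star_pow, hζ.pow_eq_one]
      simp
    rw [geom_sum_eq hr1, hrN]
    simp

lemma ite_and_add_ite_or (P Q : Prop) [Decidable P] [Decidable Q] (D : ℂ) :
    (if P ∧ Q then 1 / D else 0) + (if P ∨ Q then 1 / D else 0) =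
      ((if P then 1 else 0) + (if Q then 1 else 0)) / D := by
  by_cases hP : P <;> by_cases hQ : Q <;> simp [hP, hQ]
  ring

/-- A finite weighted complex projective 2-design. -/
lemma exists_projective_two_design (hd : 0 < d) :
    ∃ (w : Fin d ⊕ Fin (2 ^ (d + 1)) → ℝ) (v : Fin d ⊕ Fin (2 ^ (d + 1)) → Fin d → ℂ),
      (∀ t, 0 ≤ w t) ∧ ∑ t, w t = 1 ∧ (∀ t, v t ⬝ᵥ star (v t) = 1) ∧
      ∀ i k j l, ∑ t, (w t : ℂ) * (v t i * star (v t k) * (star (v t j) * v t l)) =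
        ((if i = j ∧ k = l then 1 else 0) + (if i = k ∧ j = l then 1 else 0)) / (d * (d + 1)) := by
  have hN : (2 ^ (d + 1) : ℕ) ≠ 0 := by positivity
  set ζ : ℂ := Complex.exp (2 * Real.pi * Complex.I / (2 ^ (d + 1) : ℕ))
  have hζ : IsPrimitiveRoot ζ (2 ^ (d + 1)) := Complex.isPrimitiveRoot_exp _ hN
  have hdR : (0 : ℝ) < d := by exact_mod_cast hd
  have hdC : (d : ℂ) ≠ 0 := by exact_mod_cast hd.ne'
  have hdC1 : (d : ℂ) + 1 ≠ 0 := by exact_mod_cast (Nat.succ_ne_zero d)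
  set r : ℂ := ((1 / √(d : ℝ) : ℝ) : ℂ) with hr
  have hrr : r * star r = 1 / d := by
    rw [hr, Complex.star_def, Complex.conj_ofReal, ← Complex.ofReal_mul, ← sq, div_pow, one_pow,
      Real.sq_sqrt (Nat.cast_nonneg d)]
    simp
  have hnorm : ζ * star ζ = 1 := by
    rw [Complex.star_def, Complex.mul_conj, Complex.normSq_eq_norm_sq, hζ.norm'_eq_one hN]
    simp
  -- The phase vectors count `i = j = k = l` once where a 2-design needs it twice; standard basis
  -- vectors of weight `1/(d(d+1))` supply the missing term.
  refine ⟨Sum.elim (fun _ => 1 / (d * (d + 1))) (fun _ => d / (d + 1) / 2 ^ (d + 1)),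
    Sum.elim (fun x => Pi.single x 1) (fun t i => r * ζ ^ ((t : ℕ) * 2 ^ (i : ℕ))), ?_, ?_, ?_, ?_⟩
  · rintro (t | t) <;> simp only [Sum.elim_inl, Sum.elim_inr] <;> positivity
  · simp only [Fintype.sum_sum_type, Sum.elim_inl, Sum.elim_inr, Finset.sum_const, Finset.card_univ,
      Fintype.card_fin, nsmul_eq_mul]
    push_cast
    field_simp
    ring
  · rintro (t | t)
    · simp
    · simp only [Sum.elim_inr, dotProduct, Pi.star_apply]
      have : ∀ i : Fin d, r * ζ ^ ((t : ℕ) * 2 ^ (i : ℕ)) * star (r * ζ ^ ((t : ℕ) * 2 ^ (i : ℕ))) =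
          1 / d := by
        intro i
        rw [star_mul', star_pow, mul_mul_mul_comm, hrr, ← mul_pow, hnorm, one_pow, mul_one]
      simp only [this]
      simp [hdC]
  · intro i k j l
    have h2 : ∑ t : Fin (2 ^ (d + 1)), ((d / (d + 1) / 2 ^ (d + 1) : ℝ) : ℂ) *
        (r * ζ ^ ((t : ℕ) * 2 ^ (i : ℕ)) * star (r * ζ ^ ((t : ℕ) * 2 ^ (k : ℕ))) *
          (star (r * ζ ^ ((t : ℕ) * 2 ^ (j : ℕ))) * (r * ζ ^ ((t : ℕ) * 2 ^ (l : ℕ))))) =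
        if (i = j ∧ k = l) ∨ (i = k ∧ j = l) then 1 / (d * (d + 1) : ℂ) else 0 := by
      have hm := sum_phase_moments hζ i k j l
      rw [← Fin.sum_univ_eq_sum_range (fun t => ζ ^ (t * 2 ^ (i : ℕ)) *
        star (ζ ^ (t * 2 ^ (k : ℕ))) * (star (ζ ^ (t * 2 ^ (j : ℕ))) * ζ ^ (t * 2 ^ (l : ℕ))))] at hm
      calc _ = ((d / (d + 1) / 2 ^ (d + 1) : ℝ) : ℂ) * (r * star r) ^ 2 *
            ∑ t : Fin (2 ^ (d + 1)), ζ ^ ((t : ℕ) * 2 ^ (i : ℕ)) *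
              star (ζ ^ ((t : ℕ) * 2 ^ (k : ℕ))) *
              (star (ζ ^ ((t : ℕ) * 2 ^ (j : ℕ))) * ζ ^ ((t : ℕ) * 2 ^ (l : ℕ))) := by
            rw [Finset.mul_sum]
            refine Finset.sum_congr rfl fun t _ => ?_
            simp only [star_mul']
            ring
        _ = _ := by
            rw [hm, hrr]
            split_ifs
            · push_cast
              field_simp
            · simp
    have h1 : ∑ x : Fin d, ((1 / (d * (d + 1)) : ℝ) : ℂ) *
        ((Pi.single x 1 : Fin d → ℂ) i * star ((Pi.single x 1 : Fin d → ℂ) k) *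
          (star ((Pi.single x 1 : Fin d → ℂ) j) * (Pi.single x 1 : Fin d → ℂ) l)) =
        if (i = j ∧ k = l) ∧ (i = k ∧ j = l) then 1 / (d * (d + 1) : ℂ) else 0 := by
      rw [Finset.sum_eq_single i]
      · simp only [Pi.single_apply]
        by_cases hk : k = i <;> by_cases hj : j = i <;> by_cases hl : l = i <;>
          simp [hk, hj, hl, eq_comm] <;> aesop
      · intro x _ hx
        simp [Pi.single_apply, hx.symm]
      · simp
    simp only [Fintype.sum_sum_type, Sum.elim_inl, Sum.elim_inr]
    rw [h1, h2]
    exact ite_and_add_ite_or _ _ _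

/-! ### The optimal decomposition and the conclusion -/

/-- The isotropic state is a mixture of pure states of concurrence `ξ(F)`. -/
lemma xi_mem_decompositionValues {q s : ℝ} (hd : 2 ≤ d) (hq : 1 ≤ q) (hqs : 1 ≤ q * s) {F : ℝ}
    (hF : 1 / (d : ℝ) ≤ F) (hF1 : F ≤ 1) :
    xi F q s d ∈ decompositionValues q s (isotropicState d F) := by
  have hd' : (2 : ℝ) ≤ d := by exact_mod_cast hd
  have hF0 : 0 ≤ F := le_trans (by positivity) hF
  obtain ⟨w, v, hw, hw1, hv, hm⟩ := exists_projective_two_design (d := d) (by omega)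
  have hδ := deltaCoeff_nonneg hd hF
  have hγ := gammaCoeff_nonneg (d := d) (F := F)
  have hsq := sq_gammaCoeff_add_mul_sq_deltaCoeff hd hF0 hF1
  have hκ : (gammaCoeff d F - deltaCoeff d F) ^ 2 = d * (1 - F) / (d - 1) := by
    rw [gammaCoeff_sub_deltaCoeff hd, mul_pow, div_pow, Real.sq_sqrt (by linarith),
      Real.sq_sqrt (by linarith), Real.sq_sqrt (by linarith), mul_div_assoc]
  set a := deltaCoeff d F
  set c := gammaCoeff d F
  have hmem := mem_decompositionValues (q := q) (s := s) (ρ := isotropicState d F) w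
    (fun t => spikedState a c (v t)) hw hw1 (fun t => norm_spikedState (hv t) hsq) ?_
  · simp only [fun t => pureConcurrence_spikedState hq hqs hδ hγ (hv t), ← Finset.sum_mul, hw1,
      one_mul] at hmem
    exact hmem
  have hdC : (d : ℂ) ≠ 0 := by exact_mod_cast (by omega : d ≠ 0)
  have hdC1 : (d : ℂ) + 1 ≠ 0 := by exact_mod_cast (Nat.succ_ne_zero d)
  -- Second moments come from contracting `j = l` in the fourth moments, as each `v t` is a unit
  -- vector.
  have hm1 : ∀ i k, ∑ t, (w t : ℂ) * (v t i * star (v t k)) = (if i = k then 1 else 0) / d := by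
    intro i k
    calc _ = ∑ j, ∑ t, (w t : ℂ) * (v t i * star (v t k) * (star (v t j) * v t j)) := by
          rw [Finset.sum_comm]
          refine Finset.sum_congr rfl fun t _ => ?_
          rw [← Finset.mul_sum, ← Finset.mul_sum]
          have : ∑ j, star (v t j) * v t j = 1 := by
            rw [← hv t, dotProduct]
            exact Finset.sum_congr rfl fun j _ => mul_comm _ _
          rw [this, mul_one]
      _ = _ := by
          simp only [hm, ← Finset.sum_div, Finset.sum_add_distrib, and_true]
          by_cases h : i = k
          · subst h
            simp
            field_simp
            ring
          · have : ∀ j, ¬ (i = j ∧ k = j) := fun j hj => h (hj.1.trans hj.2.symm)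
            simp [h, this]
  have hw1' : ∑ t, (w t : ℂ) = 1 := by exact_mod_cast hw1
  -- `e1` and `e2` match the coefficients of the index patterns `i = j, k = l` and `i = k, j = l` in
  -- `ρ_F`.
  have e1 : (c - a) ^ 2 / (d * (d + 1)) = (1 - F) / ((d : ℝ) ^ 2 - 1) := by
    rw [hκ, div_div, div_eq_div_iff (by
      have : 0 < (d : ℝ) - 1 := by linarith
      positivity) (by nlinarith)]
    ring
  have e2 : a ^ 2 + 2 * a * (c - a) / d + (c - a) ^ 2 / (d * (d + 1)) =
      (F - (1 - F) / ((d : ℝ) ^ 2 - 1)) / d := by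
    have e3 : a ^ 2 + 2 * a * (c - a) / d = (1 - (c - a) ^ 2) / d := by
      have : (d : ℝ) ≠ 0 := by linarith
      field_simp
      linear_combination hsq
    rw [e3, e1, hκ]
    have h1 : (d : ℝ) - 1 ≠ 0 := by linarith
    have h2 : (d : ℝ) ^ 2 - 1 ≠ 0 := by nlinarith
    have h3 : (d : ℝ) ≠ 0 := by linarith
    field_simp
    ring
  ext ⟨i, k⟩ ⟨j, l⟩
  have hterm : ∀ t, (w t : ℂ) * ketBra (spikedState a c (v t)) (i, k) (j, l) =
      (w t : ℂ) * ((if i = k ∧ j = l then 1 else 0) * (a : ℂ) ^ 2) +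
      (w t : ℂ) * (v t l * star (v t j)) * ((if i = k then 1 else 0) * (a * (c - a))) +
      (w t : ℂ) * (v t i * star (v t k)) * ((if j = l then 1 else 0) * (a * (c - a))) +
      (w t : ℂ) * (v t i * star (v t k) * (star (v t j) * v t l)) * ((c : ℂ) - a) ^ 2 := by
    intro t
    simp only [ketBra, Matrix.vecMulVec_apply, Pi.star_apply, spikedState, star_add, star_mul',
      Complex.star_def, Complex.conj_ofReal, apply_ite (starRingEnd ℂ), map_zero]
    by_cases h1 : i = k <;> by_cases h2 : j = l <;> simp [h1, h2] <;> ring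
  rw [isotropicState_apply, ← e1, Matrix.sum_apply]
  simp only [Matrix.smul_apply, smul_eq_mul, hterm, Finset.sum_add_distrib, ← Finset.sum_mul, hw1',
    hm1, hm]
  have e2' := congrArg (fun x : ℝ => (x : ℂ)) e2
  rw [← e1] at e2'
  push_cast at e2' ⊢
  have hite : ∀ z : ℂ, (if i = k ∧ j = l then z else 0) =
      (if i = k then 1 else 0) * (if j = l then 1 else 0) * z := by
    intro z
    by_cases h1 : i = k <;> by_cases h2 : j = l <;> simp [h1, h2]
  simp only [hite, eq_comm (a := l)]
  generalize (d * (d + 1) : ℂ) = D at e2' ⊢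
  linear_combination -((if i = k then 1 else 0) * (if j = l then 1 else 0) : ℂ) * e2'

/-- For `q ≥ 1`, `q s ≥ 1`, the unified concurrence of the isotropic states is the convex envelope
of `ξ` on `(1/d, 1]`. -/
theorem isConvexEnvelopeOn_concurrence_isotropicState {q s : ℝ} (hd : 2 ≤ d) (hq : 1 ≤ q)
    (hqs : 1 ≤ q * s) :
    IsConvexEnvelopeOn (Set.Ioc (1 / (d : ℝ)) 1) (fun F => xi F q s d)
      (fun F => concurrence q s (isotropicState d F)) := by
  have hmem : ∀ F ∈ Set.Ioc (1 / (d : ℝ)) 1,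
      xi F q s d ∈ decompositionValues q s (isotropicState d F) :=
    fun F hF => xi_mem_decompositionValues hd hq hqs hF.1.le hF.2
  refine ⟨⟨convex_Ioc _ _, ?_⟩, ?_, ?_⟩
  · intro F hF G hG a b ha hb hab
    simp only [smul_eq_mul]
    rw [isotropicState_combo d hab]
    exact concurrence_combo_le hq hqs ⟨_, hmem F hF⟩ ⟨_, hmem G hG⟩ ha hb hab
  · exact fun F hF =>
      csInf_le ⟨0, fun z hz => decompositionValues_nonneg hq hqs hz⟩ (hmem F hF)
  · exact fun h hconv hle F hF => le_csInf ⟨_, hmem F hF⟩ fun x hx =>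
      le_of_mem_decompositionValues hd hq hqs hconv hle hF hx

end UnifiedConcurrence

theorem mainTheorem4 (d : ℕ) (hd : 2 ≤ d) (q s : ℝ) (hq : 1 ≤ q) (hqs : 1 ≤ q * s) :
    UnifiedConcurrence.IsConvexEnvelopeOn (Set.Ioc (1 / (d : ℝ)) 1)
      (fun F : ℝ => UnifiedConcurrence.xi F q s d)
      (fun F : ℝ =>
        UnifiedConcurrence.concurrence q s (UnifiedConcurrence.isotropicState d F)) := by
  exact UnifiedConcurrence.isConvexEnvelopeOn_concurrence_isotropicState hd hq hqs
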